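/- Consider the scalar system $$y_{t+1}=\theta f(y_t)+u_t+w_{t+1},\qquad t\ge 0,$$ where $f:\mathbb R\to\mathbb R$ is a known piecewise continuous function (finitely many discontinuities in every bounded interval), the noise $(w_t)_{t\ge1}$ is i.i.d. with $w_1\sim N(0,1)$, and the parameter $\theta\sim N(\theta_0,P_0)$, $P_0>0$, is independent of $(w_t)_{t\ge1}$. A feedback law is a sequence $u_t=u_t(y_0,\dots,y_t)$, $t\ge0$, of Borel functions of the observed outputs. The system is called unstabilizable if for every feedback law there exist an initial value $y_0\in\mathbb R$ and an event $D$ with $P(D)>0$ such that $$\limsup_{t\to+\infty}\frac1t\sum_{i=1}^t y_i^2=+\infty\quad\text{on } D.$$ Let $h:[0,+\infty)\to[0,+\infty)$ be monotone increasing (not necessarily strictly) and piecewise continuous, with $h(x)=O(x^4)+O(1)$ as $x\to+\infty$. Let $h^{-1}(y)=\sup\{x\ge 0: h(x)\le y\}\in[0,+\infty]$ (with $\sup\emptyset=0$) be its generalized inverse, which is the usual inverse when $h$ is an increasing bijection of $[0,+\infty)$, and let $g(x)=|x|^{-1/4}h^{-1}(|x|)$. Suppose that $$\sum_{t=1}^{+\infty}\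 \sup_{x\in[e^{2^t},+\infty)}x^{-\frac1{16t^2}}\,g(x)<+\infty,$$ and that, with $S_h=\{x\in\mathbb R:|f(x)|<h(|x|)\}$ and $\ell$ the Lebesgue measure, there is a $\delta>0$ such that, as $l\to+\infty$, $$\sup_{x\in\mathbb R}\frac{\ell\big(S_h\cap[x-l,x+l]\big)}{l}=O\!\left(\frac1{(\log\log l)^{1+\delta}}\right).$$ Then the system is unstabilizable. -/

import Mathlib

open MeasureTheory ProbabilityTheory Filter Asymptotics
open scoped ENNReal NNReal

noncomputable section

/-- `f` is piecewise continuous on `s`: every bounded interval contains only finitely many points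
of `s` at which `f` (restricted to `s`) is discontinuous. Nothing is required of the one-sided
limits at these points. -/
def PiecewiseContinuousOn (f : ℝ → ℝ) (s : Set ℝ) : Prop :=
  ∀ a b : ℝ, {x ∈ s ∩ Set.Icc a b | ¬ ContinuousWithinAt f s x}.Finite

/-- The output `y_t` of the closed loop `y_{t+1} = θ f(y_t) + u_t(y_0, …, y_t) + w_{t+1}` started
at `y₀`, for a given value of the parameter and a given realization of the noise. -/
def output (f : ℝ → ℝ) (u : (t : ℕ) → (Fin (t + 1) → ℝ) → ℝ) (y₀ θ : ℝ) (w : ℕ → ℝ) : ℕ → ℝ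
  | 0 => y₀
  | t + 1 => θ * f (output f u y₀ θ w t)
      + u t (fun i : Fin (t + 1) => output f u y₀ θ w i.1) + w (t + 1)
  decreasing_by all_goals omega

theorem output_zero (f : ℝ → ℝ) (u : (t : ℕ) → (Fin (t + 1) → ℝ) → ℝ) (y₀ θ : ℝ) (w : ℕ → ℝ) :
    output f u y₀ θ w 0 = y₀ := by
  rw [output]

theorem output_succ (f : ℝ → ℝ) (u : (t : ℕ) → (Fin (t + 1) → ℝ) → ℝ) (y₀ θ : ℝ) (w : ℕ → ℝ)
    (t : ℕ) :
    output f u y₀ θ w (t + 1) = θ * f (output f u y₀ θ w t)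
      + u t (fun i : Fin (t + 1) => output f u y₀ θ w i.1) + w (t + 1) := by
  rw [output]

/-- The system `y_{t+1} = θ f(y_t) + u_t + w_{t+1}` is unstabilizable: for every feedback law,
i.e. every sequence of Borel functions `u_t` of the observed outputs `y_0, …, y_t`, there are an
initial value and an event `D` of positive probability on which
`limsup_t (1/t) ∑_{i=1}^t y_i² = +∞`. The feedback law sees neither `θ` nor the noise. -/
def Unstabilizable {Ω : Type*} [MeasurableSpace Ω] (μ : Measure Ω) (f : ℝ → ℝ)
    (θ : Ω → ℝ) (w : ℕ → Ω → ℝ) : Prop :=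
  ∀ u : (t : ℕ) → (Fin (t + 1) → ℝ) → ℝ, (∀ t, Measurable (u t)) →
    ∃ y₀ : ℝ, ∃ D : Set Ω, MeasurableSet D ∧ 0 < μ D ∧ ∀ ω ∈ D,
      limsup (fun t : ℕ => (((1 / (t : ℝ)) * ∑ i ∈ Finset.Icc 1 t,
        output f u y₀ (θ ω) (fun s => w s ω) i ^ 2 : ℝ) : EReal)) atTop = ⊤

/-- The set `S_h = {x : |f(x)| < h(|x|)}`. -/
def slowSet (f h : ℝ → ℝ) : Set ℝ := {x | |f x| < h |x|}

/-- The (generalized) inverse `h⁻¹(y) = sup {x ≥ 0 : h(x) ≤ y}` of an increasing function `h` on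
`[0, ∞)`, which need be neither continuous nor strictly increasing. It is `∞` when `h ≤ y`
everywhere. -/
def genInverse (h : ℝ → ℝ) (y : ℝ) : ℝ≥0∞ :=
  ⨆ x ∈ {x : ℝ | 0 ≤ x ∧ h x ≤ y}, ENNReal.ofReal x

/-- On the range of a strictly increasing function, `genInverse` is the usual inverse. -/
theorem genInverse_apply (h : ℝ → ℝ) (hh : StrictMonoOn h (Set.Ici 0)) (x : ℝ) (hx : 0 ≤ x) :
    genInverse h (h x) = ENNReal.ofReal x := by
  apply le_antisymm
  · refine iSup₂_le fun z hz => ENNReal.ofReal_le_ofReal ?_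
    exact (hh.le_iff_le hz.1 hx).1 hz.2
  · exact le_iSup₂_of_le x ⟨hx, le_rfl⟩ le_rfl

/-- The function `g(x) = |x|^{-1/4} h⁻¹(|x|)`. -/
def invRatio (h : ℝ → ℝ) (x : ℝ) : ℝ≥0∞ :=
  ENNReal.ofReal (|x| ^ (-(1 / 4) : ℝ)) * genInverse h |x|

end

/-! The parameter is Gaussian and observed through a linear channel, so under any feedback law its
posterior is Gaussian with precision r_t = 1/P₀ + ∑_{i<t} f(y_i)² (`lintegral_posterior`). Given the
past, y_{t+1} is Gaussian with variance σ_t² = r_{t+1}/r_t; the control only moves its mean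
(`lintegral_next_output`). So, up to conditional probability ε plus twice the density of S_h at
scale σ_t, |y_{t+1}| > ε σ_t and y_{t+1} ∉ S_h (`measure_next_output_le`).

On such a step h(|y_{t+1}|) ≤ |f(y_{t+1})| ≤ √r_{t+2}. If ε dominates the n-th term of the series,
inverting h gives, for L_t = log r_t, the recursion L_{t+1} - L_t ≤ (1/4 + 1/(16(n+1)²)) L_{t+2}.
With 1/4 alone the characteristic polynomial is (λ-2)²; the correction is the critical one, still
compatible with growth like 2^n √n. Hence L keeps at least doubling (`FastGrowth.step`) and σ_t ≥
exp(2^n).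

Since log log σ_t ≥ n log 2, sparsity bounds the density term by O(n^{-(1+δ)}), while ε_n is the
n-th term plus 2^{-n}: both are summable. Taking n = t + T with T large, and y₀ with |f(y₀)| huge,
makes the total failure probability less than 1. Off the failures, |y_{t+1}| ≥ 2^{-n} exp(2^n). -/

/-! ### Gaussian densities in terms of precision, and Bayes' formula -/

/-- The Gaussian density with mean `m` and precision (inverse variance) `r`. -/
noncomputable def precPDF (m r x : ℝ) : ℝ≥0∞ :=
  ENNReal.ofReal (√(r / (2 * Real.pi)) * Real.exp (-(r * (x - m) ^ 2 / 2)))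

theorem measurable_precPDF : Measurable fun p : ℝ × ℝ × ℝ => precPDF p.1 p.2.1 p.2.2 := by
  unfold precPDF
  fun_prop

theorem Measurable.precPDF {α : Type*} [MeasurableSpace α] {m r x : α → ℝ} (hm : Measurable m)
    (hr : Measurable r) (hx : Measurable x) : Measurable fun a => precPDF (m a) (r a) (x a) :=
  measurable_precPDF.comp (hm.prodMk (hr.prodMk hx))

theorem precPDF_eq_gaussianPDF (m : ℝ) (v : ℝ≥0) :
    precPDF m (v : ℝ)⁻¹ = gaussianPDF m v := by
  ext x
  rw [precPDF, gaussianPDF, gaussianPDFReal]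
  congr 2
  · rw [← Real.sqrt_inv]
    congr 1
    rw [mul_inv, div_eq_mul_inv, mul_comm]
  · congr 1
    rw [neg_div, div_eq_mul_inv ((x - m) ^ 2), mul_inv]
    ring

theorem lintegral_gaussianReal (m : ℝ) {v : ℝ≥0} (hv : v ≠ 0) {F : ℝ → ℝ≥0∞} (hF : Measurable F) :
    ∫⁻ x, F x ∂gaussianReal m v = ∫⁻ x, precPDF m (v : ℝ)⁻¹ x * F x := by
  rw [gaussianReal_of_var_ne_zero _ hv, precPDF_eq_gaussianPDF,
    lintegral_withDensity_eq_lintegral_mul _ (measurable_gaussianPDF m v) hF]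
  rfl

theorem lintegral_precPDF (m : ℝ) {r : ℝ} (hr : 0 < r) : ∫⁻ x, precPDF m r x = 1 := by
  obtain ⟨v, hv⟩ : ∃ v : ℝ≥0, (v : ℝ) = r⁻¹ := ⟨⟨r⁻¹, (inv_pos.2 hr).le⟩, rfl⟩
  have hv0 : v ≠ 0 := by
    rintro rfl
    exact (inv_pos.2 hr).ne hv
  rw [← lintegral_gaussianPDF_eq_one m hv0, ← precPDF_eq_gaussianPDF, hv, inv_inv]

/-- Completing the square in the joint density of the parameter and the next output. -/
theorem precPDF_mul_precPDF (m a b x y : ℝ) {r : ℝ} (hr : 0 < r) :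
    precPDF m r x * precPDF (x * a + b) 1 y =
      precPDF (m * a + b) (r / (r + a ^ 2)) y *
        precPDF ((r * m + a * (y - b)) / (r + a ^ 2)) (r + a ^ 2) x := by
  have hr' : 0 < r + a ^ 2 := by positivity
  unfold precPDF
  rw [← ENNReal.ofReal_mul (by positivity), ← ENNReal.ofReal_mul (by positivity),
    mul_mul_mul_comm, ← Real.exp_add, mul_mul_mul_comm √(r / (r + a ^ 2) / _), ← Real.exp_add,
    ← Real.sqrt_mul (by positivity), ← Real.sqrt_mul (by positivity)]
  congr 3
  · field_simp
  · field_simp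
    ring

/-- Bayes' formula for a Gaussian parameter observed through a linear channel with standard
Gaussian noise. -/
theorem lintegral_precPDF_bayes (m a b : ℝ) {r : ℝ} (hr : 0 < r) {G : ℝ × ℝ → ℝ≥0∞}
    (hG : Measurable G) :
    ∫⁻ x, precPDF m r x * ∫⁻ w, precPDF 0 1 w * G (x, x * a + b + w) =
      ∫⁻ y, precPDF (m * a + b) (r / (r + a ^ 2)) y *
        ∫⁻ x, precPDF ((r * m + a * (y - b)) / (r + a ^ 2)) (r + a ^ 2) x * G (x, y) := by
  have shift : ∀ x, ∫⁻ w, precPDF 0 1 w * G (x, x * a + b + w) =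
      ∫⁻ y, precPDF (x * a + b) 1 y * G (x, y) := by
    intro x
    rw [← lintegral_add_left_eq_self (fun y => precPDF (x * a + b) 1 y * G (x, y)) (x * a + b)]
    refine lintegral_congr fun w => ?_
    simp [precPDF]
  simp_rw [shift]
  have m1 : ∀ x, Measurable fun y => precPDF (x * a + b) 1 y * G (x, y) := fun x =>
    (Measurable.precPDF (by fun_prop) (by fun_prop) (by fun_prop)).mul (by fun_prop)
  have m2 : ∀ y, Measurable fun x =>
      precPDF ((r * m + a * (y - b)) / (r + a ^ 2)) (r + a ^ 2) x * G (x, y) := fun y =>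
    (Measurable.precPDF (by fun_prop) (by fun_prop) (by fun_prop)).mul (by fun_prop)
  simp_rw [← lintegral_const_mul _ (m1 _), ← lintegral_const_mul _ (m2 _)]
  rw [lintegral_lintegral_swap]
  · refine lintegral_congr fun y => lintegral_congr fun x => ?_
    rw [← mul_assoc, precPDF_mul_precPDF m a b x y hr, mul_assoc]
  · refine Measurable.aemeasurable ?_
    refine Measurable.mul (Measurable.precPDF (by fun_prop) (by fun_prop) (by fun_prop)) ?_
    exact (Measurable.precPDF (by fun_prop) (by fun_prop) (by fun_prop)).mul (by fun_prop)

/-! ### Gaussian mass of short intervals and of sparse sets -/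

theorem precPDF_le (m x : ℝ) (r : ℝ) (hr : 0 ≤ r) : precPDF m r x ≤ ENNReal.ofReal (√r / 2) := by
  refine ENNReal.ofReal_le_ofReal ?_
  have h1 : √(r / (2 * Real.pi)) ≤ √(r / 4) :=
    Real.sqrt_le_sqrt (by gcongr; linarith [Real.pi_gt_three])
  have h2 : √(r / 4) = √r / 2 := by
    rw [Real.sqrt_div hr, show (4 : ℝ) = 2 ^ 2 by norm_num, Real.sqrt_sq (by norm_num)]
  have h3 : Real.exp (-(r * (x - m) ^ 2 / 2)) ≤ 1 := Real.exp_le_one_iff.2 (by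
    have : 0 ≤ r * (x - m) ^ 2 := by positivity
    linarith)
  calc _ ≤ √(r / 4) * 1 := by gcongr
    _ = _ := by rw [h2, mul_one]

/-- A Gaussian variable with standard deviation `σ` lies in `[-ε σ, ε σ]` with probability at
most `ε`. -/
theorem lintegral_precPDF_Icc_le (m ε : ℝ) {σ : ℝ} (hσ : 0 < σ) :
    ∫⁻ x in Set.Icc (-(ε * σ)) (ε * σ), precPDF m (σ ^ 2)⁻¹ x ≤ ENNReal.ofReal ε := by
  have hs : √((σ ^ 2)⁻¹) = σ⁻¹ := by rw [Real.sqrt_inv, Real.sqrt_sq hσ.le]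
  calc _ ≤ ∫⁻ x in Set.Icc (-(ε * σ)) (ε * σ), ENNReal.ofReal (σ⁻¹ / 2) := by
        refine lintegral_mono fun x => ?_
        rw [← hs]
        exact precPDF_le _ _ _ (by positivity)
    _ = ENNReal.ofReal ε := by
        rw [setLIntegral_const, Real.volume_Icc, ← ENNReal.ofReal_mul (by positivity)]
        congr 1
        field_simp
        ring

/-- Harnack-type comparison of a Gaussian density with the one of twice the variance. -/
theorem precPDF_le_of_dist_le (m : ℝ) {σ x z : ℝ} (hσ : 0 < σ) (hxz : |x - z| ≤ σ) :
    precPDF m (σ ^ 2)⁻¹ x ≤ 4 * precPDF m (2 * σ ^ 2)⁻¹ z := by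
  unfold precPDF
  rw [show (4 : ℝ≥0∞) = ENNReal.ofReal 4 by simp, ← ENNReal.ofReal_mul (by norm_num)]
  refine ENNReal.ofReal_le_ofReal ?_
  -- The factor is 3/2 ≥ √2; with exp(1/2) ≤ 2 below, the total constant is 3 ≤ 4.
  have h1 : √((σ ^ 2)⁻¹ / (2 * Real.pi)) ≤ 4 / 3 * 9 / 8 * √((2 * σ ^ 2)⁻¹ / (2 * Real.pi)) := by
    rw [show (4 / 3 * 9 / 8 : ℝ) = √((3 / 2) ^ 2) by rw [Real.sqrt_sq] <;> norm_num,
      ← Real.sqrt_mul (by positivity)]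
    refine Real.sqrt_le_sqrt ?_
    have : 0 ≤ (σ ^ 2)⁻¹ / (2 * Real.pi) := by positivity
    calc _ ≤ 9 / 8 * ((σ ^ 2)⁻¹ / (2 * Real.pi)) := by linarith
      _ = _ := by field_simp; norm_num
  have hsq : (x - z) ^ 2 ≤ σ ^ 2 := by
    rw [← sq_abs (x - z)]
    gcongr
  have h2 : Real.exp (-((σ ^ 2)⁻¹ * (x - m) ^ 2 / 2)) ≤
      2 * Real.exp (-((2 * σ ^ 2)⁻¹ * (z - m) ^ 2 / 2)) := by
    have he : Real.exp (1 / 2) ≤ 2 := by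
      have := Real.exp_one_lt_d9
      have h3 : Real.exp (1 / 2) ^ 2 = Real.exp 1 := by
        rw [← Real.exp_nat_mul]; norm_num
      nlinarith [Real.exp_pos (1 / 2 : ℝ)]
    calc _ ≤ Real.exp (1 / 2 + -((2 * σ ^ 2)⁻¹ * (z - m) ^ 2 / 2)) := by
          refine Real.exp_le_exp.2 ?_
          have : (z - m) ^ 2 ≤ 2 * (x - m) ^ 2 + 2 * σ ^ 2 := by
            nlinarith [sq_nonneg ((x - m) + (x - z))]
          have h4 : (2 * σ ^ 2)⁻¹ * (z - m) ^ 2 ≤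
              (2 * σ ^ 2)⁻¹ * (2 * (x - m) ^ 2 + 2 * σ ^ 2) := by gcongr
          have h5 : (2 * σ ^ 2)⁻¹ * (2 * (x - m) ^ 2 + 2 * σ ^ 2) =
              (σ ^ 2)⁻¹ * (x - m) ^ 2 + 1 := by field_simp
          linarith
      _ ≤ _ := by rw [Real.exp_add]; gcongr
  calc _ ≤ 4 / 3 * 9 / 8 * √((2 * σ ^ 2)⁻¹ / (2 * Real.pi)) *
        (2 * Real.exp (-((2 * σ ^ 2)⁻¹ * (z - m) ^ 2 / 2))) := by gcongr
    _ ≤ _ := by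
      have : 0 ≤ √((2 * σ ^ 2)⁻¹ / (2 * Real.pi)) *
        Real.exp (-((2 * σ ^ 2)⁻¹ * (z - m) ^ 2 / 2)) := by positivity
      linarith

/-- The Gaussian mass of a set is controlled by its density in the windows of size `σ`. -/
theorem lintegral_precPDF_le_of_density (m : ℝ) {σ b : ℝ} (hσ : 0 < σ) {S : Set ℝ}
    (hb : ∀ z, volume (S ∩ Set.Icc (z - σ) (z + σ)) ≤ ENNReal.ofReal (b * σ)) :
    ∫⁻ x in S, precPDF m (σ ^ 2)⁻¹ x ≤ ENNReal.ofReal (2 * b) := by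
  have hpos : ENNReal.ofReal (2 * σ) ≠ 0 := by simpa using hσ
  -- Double counting: spread the mass at x over the window of radius σ around x, move the density
  -- from x to z by the Harnack comparison, and exchange the integrals. What remains in x is the
  -- measure of S in the window around z.
  have key : ENNReal.ofReal (2 * σ) * ∫⁻ x in S, precPDF m (σ ^ 2)⁻¹ x ≤
      ENNReal.ofReal (2 * σ) * ENNReal.ofReal (2 * b) := by
    calc ENNReal.ofReal (2 * σ) * ∫⁻ x in S, precPDF m (σ ^ 2)⁻¹ x
        = ∫⁻ x in S, ∫⁻ z, (Set.Icc (x - σ) (x + σ)).indicator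
            (fun _ => precPDF m (σ ^ 2)⁻¹ x) z := by
          rw [← lintegral_const_mul _ (Measurable.precPDF (by fun_prop) (by fun_prop)
            (by fun_prop))]
          refine lintegral_congr fun x => ?_
          rw [lintegral_indicator measurableSet_Icc, setLIntegral_const, Real.volume_Icc, mul_comm]
          congr 2
          ring
      _ ≤ ∫⁻ x in S, ∫⁻ z, 4 * precPDF m (2 * σ ^ 2)⁻¹ z *
            {p : ℝ × ℝ | |p.1 - p.2| ≤ σ}.indicator 1 (x, z) := by
          refine lintegral_mono fun x => lintegral_mono fun z => ?_
          by_cases hz : |x - z| ≤ σ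
          · rw [Set.indicator_of_mem (show (x, z) ∈ {p : ℝ × ℝ | |p.1 - p.2| ≤ σ} from hz)]
            simp only [Pi.one_apply, mul_one]
            exact (Set.indicator_le_self _ _ _).trans (precPDF_le_of_dist_le m hσ hz)
          · rw [Set.indicator_of_notMem]
            · exact zero_le
            · intro hmem
              exact hz (abs_le.2 ⟨by linarith [hmem.2], by linarith [hmem.1]⟩)
      _ = ∫⁻ z, ∫⁻ x in S, 4 * precPDF m (2 * σ ^ 2)⁻¹ z *
            {p : ℝ × ℝ | |p.1 - p.2| ≤ σ}.indicator 1 (x, z) := by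
          refine lintegral_lintegral_swap (Measurable.aemeasurable ?_)
          refine Measurable.mul (measurable_const.mul
            (Measurable.precPDF (by fun_prop) (by fun_prop) (by fun_prop))) ?_
          refine (measurable_one.indicator ?_)
          exact measurableSet_le (by fun_prop) (by fun_prop)
      _ ≤ ∫⁻ z, 4 * precPDF m (2 * σ ^ 2)⁻¹ z * ENNReal.ofReal (b * σ) := by
          refine lintegral_mono fun z => ?_
          have hm : MeasurableSet {x : ℝ | |x - z| ≤ σ} :=
            measurableSet_le (by fun_prop) (by fun_prop)
          rw [lintegral_const_mul]
          · gcongr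
            refine le_trans (le_of_eq ?_) (hb z)
            have : (fun x => {p : ℝ × ℝ | |p.1 - p.2| ≤ σ}.indicator (1 : ℝ × ℝ → ℝ≥0∞) (x, z)) =
                {x : ℝ | |x - z| ≤ σ}.indicator 1 := by
              ext x
              simp [Set.indicator]
            rw [this, lintegral_indicator_one hm, Measure.restrict_apply hm, Set.inter_comm]
            congr 2
            ext x
            simp only [Set.mem_ofPred_eq, Set.mem_Icc, abs_le]
            constructor <;> rintro ⟨h1, h2⟩ <;> constructor <;> linarith
          · exact (measurable_one.indicator
              (measurableSet_le (by fun_prop) (by fun_prop))).comp (by fun_prop)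
      _ = ENNReal.ofReal (2 * σ) * ENNReal.ofReal (2 * b) := by
          rw [lintegral_mul_const _ (Measurable.const_mul
            (Measurable.precPDF (by fun_prop) (by fun_prop) (by fun_prop)) _),
            lintegral_const_mul _ (Measurable.precPDF (by fun_prop) (by fun_prop) (by fun_prop)),
            lintegral_precPDF _ (by positivity), mul_one,
            show (4 : ℝ≥0∞) = ENNReal.ofReal 4 by simp, ← ENNReal.ofReal_mul (by norm_num),
            ← ENNReal.ofReal_mul (by positivity)]
          congr 1
          ring
  exact (ENNReal.mul_le_mul_iff_right hpos ENNReal.ofReal_ne_top).1 key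

/-! ### Measurability and independence -/

/-- The discontinuities form a countable set, so the preimage of an open set is its interior plus
countably many points. -/
theorem PiecewiseContinuousOn.measurable {f : ℝ → ℝ} (hf : PiecewiseContinuousOn f Set.univ) :
    Measurable f := by
  have hc : {x | ¬ ContinuousAt f x}.Countable := by
    have : {x | ¬ ContinuousAt f x} ⊆
        ⋃ n : ℕ, {x ∈ Set.univ ∩ Set.Icc (-(n : ℝ)) n | ¬ ContinuousWithinAt f Set.univ x} := by
      intro x hx
      obtain ⟨n, hn⟩ := exists_nat_ge |x|
      refine Set.mem_iUnion.2 ⟨n, ⟨⟨trivial, abs_le.1 hn⟩, ?_⟩⟩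
      rwa [continuousWithinAt_univ]
    exact (Set.countable_iUnion fun n : ℕ => (hf (-(n : ℝ)) n).countable).mono this
  refine measurable_of_isOpen fun U hU => ?_
  have : f ⁻¹' U = interior (f ⁻¹' U) ∪ (f ⁻¹' U ∩ {x | ¬ ContinuousAt f x}) := by
    ext x
    constructor
    · intro hx
      by_cases hcx : ContinuousAt f x
      · exact Or.inl (mem_interior_iff_mem_nhds.2 (hcx (hU.mem_nhds hx)))
      · exact Or.inr ⟨hx, hcx⟩
    · rintro (hx | hx)
      exacts [interior_subset hx, hx.1]
  rw [this]
  exact isOpen_interior.measurableSet.union (hc.mono Set.inter_subset_right).measurableSet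

/-- Both hypotheses together factor the joint law of the triple into its three marginals;
associativity of the product measure regroups them. -/
theorem ProbabilityTheory.IndepFun.prodMk_left {Ω α β γ : Type*} [MeasurableSpace Ω]
    [MeasurableSpace α] [MeasurableSpace β] [MeasurableSpace γ] {μ : Measure Ω}
    [IsProbabilityMeasure μ] {X : Ω → α} {Y : Ω → β} {Z : Ω → γ} (hX : Measurable X)
    (hY : Measurable Y) (hZ : Measurable Z) (h : IndepFun X (fun ω => (Y ω, Z ω)) μ)
    (hYZ : IndepFun Y Z μ) : IndepFun (fun ω => (X ω, Y ω)) Z μ := by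
  have hXY : IndepFun X Y μ := h.comp measurable_id measurable_fst
  have := Measure.isProbabilityMeasure_map (μ := μ) hX.aemeasurable
  have := Measure.isProbabilityMeasure_map (μ := μ) hY.aemeasurable
  have := Measure.isProbabilityMeasure_map (μ := μ) hZ.aemeasurable
  rw [indepFun_iff_map_prod_eq_prod_map_map (by fun_prop) (by fun_prop)] at h hYZ hXY ⊢
  rw [hXY]
  rw [hYZ, ← (measurePreserving_prodAssoc (μ.map X) (μ.map Y) (μ.map Z)).map_eq] at h
  refine MeasurableEquiv.prodAssoc.map_measurableEquiv_injective ?_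
  rw [← h, Measure.map_map (by fun_prop) (by fun_prop)]
  rfl

/-! ### Paths and posterior statistics -/

/-- The path `y` stopped at time `t`. -/
def stoppedPath (y : ℕ → ℝ) (t : ℕ) : ℕ → ℝ := fun i => y (min i t)

/-- Continue a path, known up to time `t`, by the value `v`. -/
def extendPath (t : ℕ) (y : ℕ → ℝ) (v : ℝ) : ℕ → ℝ := fun i => if i ≤ t then y i else v

theorem stoppedPath_apply_of_le (y : ℕ → ℝ) {t i : ℕ} (h : i ≤ t) : stoppedPath y t i = y i := by
  rw [stoppedPath, min_eq_left h]

theorem extendPath_stoppedPath (y : ℕ → ℝ) (t : ℕ) :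
    extendPath t (stoppedPath y t) (y (t + 1)) = stoppedPath y (t + 1) := by
  ext i
  unfold extendPath stoppedPath
  split_ifs with h
  · rw [min_eq_left h, min_eq_left (h.trans t.le_succ)]
  · rw [min_eq_right (by omega)]

theorem measurable_extendPath (t : ℕ) :
    Measurable fun p : ℝ × (ℕ → ℝ) => extendPath t p.2 p.1 := by
  refine measurable_pi_lambda _ fun i => ?_
  unfold extendPath
  split_ifs <;> fun_prop

/-- The posterior precision of the parameter, given the outputs up to time `t`. -/
noncomputable def postPrec (f : ℝ → ℝ) (r₀ : ℝ) (t : ℕ) (y : ℕ → ℝ) : ℝ :=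
  r₀ + ∑ i ∈ Finset.range t, f (y i) ^ 2

/-- The posterior mean of the parameter, given the outputs up to time `t`. -/
noncomputable def postMean (f : ℝ → ℝ) (u : (t : ℕ) → (Fin (t + 1) → ℝ) → ℝ) (θ₀ r₀ : ℝ) :
    ℕ → (ℕ → ℝ) → ℝ
  | 0, _ => θ₀
  | t + 1, y => (postPrec f r₀ t y * postMean f u θ₀ r₀ t y
      + f (y t) * (y (t + 1) - u t fun i => y i)) / postPrec f r₀ (t + 1) y

section
variable {f : ℝ → ℝ} {u : (t : ℕ) → (Fin (t + 1) → ℝ) → ℝ}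

theorem postPrec_succ (r₀ : ℝ) (t : ℕ) (y : ℕ → ℝ) :
    postPrec f r₀ (t + 1) y = postPrec f r₀ t y + f (y t) ^ 2 := by
  rw [postPrec, Finset.sum_range_succ, ← add_assoc, ← postPrec]

theorem postPrec_pos {r₀ : ℝ} (h : 0 < r₀) (t : ℕ) (y : ℕ → ℝ) : 0 < postPrec f r₀ t y := by
  unfold postPrec
  positivity

/-- The strict `i < t` matters: the precision at time t + 1 is already known at time t, so the
predictive variance of the next output is a function of the past. -/
theorem postPrec_congr (r₀ : ℝ) {t : ℕ} {y z : ℕ → ℝ} (h : ∀ i < t, y i = z i) :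
    postPrec f r₀ t y = postPrec f r₀ t z := by
  unfold postPrec
  congr 1
  exact Finset.sum_congr rfl fun i hi => by rw [h i (Finset.mem_range.1 hi)]

theorem postMean_congr (θ₀ r₀ : ℝ) {t : ℕ} {y z : ℕ → ℝ} (h : ∀ i ≤ t, y i = z i) :
    postMean f u θ₀ r₀ t y = postMean f u θ₀ r₀ t z := by
  induction t with
  | zero => rfl
  | succ t ih =>
    have hu : (fun i : Fin (t + 1) => y i) = fun i : Fin (t + 1) => z i :=
      funext fun i => h i (by omega)
    rw [postMean, postMean, ih fun i hi => h i (by omega), h t (by omega), h (t + 1) le_rfl, hu,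
      postPrec_congr r₀ (t := t) fun i hi => h i (by omega),
      postPrec_congr r₀ (t := t + 1) fun i hi => h i (by omega)]

theorem measurable_postPrec (hf : Measurable f) (r₀ : ℝ) (t : ℕ) :
    Measurable (postPrec f r₀ t) := by
  unfold postPrec
  fun_prop

theorem measurable_postMean (hf : Measurable f) (hu : ∀ t, Measurable (u t)) (θ₀ r₀ : ℝ) (t : ℕ) :
    Measurable (postMean f u θ₀ r₀ t) := by
  induction t with
  | zero => exact measurable_const
  | succ t ih =>
    have h1 := measurable_postPrec hf r₀ t
    have h2 := measurable_postPrec hf r₀ (t + 1)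
    have h3 : Measurable fun y : ℕ → ℝ => u t fun i => y i :=
      (hu t).comp (measurable_pi_lambda _ fun i => measurable_pi_apply _)
    simp only [postMean]
    fun_prop

theorem output_congr (y₀ x : ℝ) {w w' : ℕ → ℝ} {t : ℕ} (h : ∀ i < t, w (i + 1) = w' (i + 1)) :
    output f u y₀ x w t = output f u y₀ x w' t := by
  induction t using Nat.strong_induction_on with
  | _ t ih =>
    cases t with
    | zero => rw [output_zero, output_zero]
    | succ t =>
      have hu : (fun i : Fin (t + 1) => output f u y₀ x w i) =
          fun i : Fin (t + 1) => output f u y₀ x w' i :=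
        funext fun i => ih i i.2 fun j hj => h j (by omega)
      rw [output_succ, output_succ, hu, ih t t.lt_succ_self fun j hj => h j (by omega),
        h t t.lt_succ_self]

/-- The noise starts at time 1 and is stored from position 0, whence `i - 1`. The entry at time 0 is
never read, and `w 0` is nowhere assumed measurable. -/
theorem measurable_output (hf : Measurable f) (hu : ∀ t, Measurable (u t)) (y₀ : ℝ) (t : ℕ) :
    Measurable fun p : ℝ × (ℕ → ℝ) => output f u y₀ p.1 (fun i => p.2 (i - 1)) t := by
  induction t using Nat.strong_induction_on with
  | _ t ih =>
    cases t with
    | zero => simp only [output_zero, measurable_const]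
    | succ t =>
      simp only [output_succ]
      have h1 := ih t t.lt_succ_self
      have h2 : Measurable fun p : ℝ × (ℕ → ℝ) =>
          u t fun i => output f u y₀ p.1 (fun i => p.2 (i - 1)) i :=
        (hu t).comp (measurable_pi_lambda _ fun i => ih i i.2)
      exact ((measurable_fst.mul (hf.comp h1)).add h2).add
        ((measurable_pi_apply _).comp measurable_snd)

end

/-! ### Conditional laws of the parameter and of the next output -/

section
variable {Ω : Type*} [MeasurableSpace Ω] {μ : Measure Ω} [IsProbabilityMeasure μ]
  {f : ℝ → ℝ} {u : (t : ℕ) → (Fin (t + 1) → ℝ) → ℝ} {θ : Ω → ℝ} {w : ℕ → Ω → ℝ}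

theorem measurable_output_comp (hf : Measurable f) (hu : ∀ t, Measurable (u t)) (hθ : Measurable θ)
    (hw : ∀ t, Measurable (w (t + 1))) (y₀ : ℝ) (t : ℕ) :
    Measurable fun ω => output f u y₀ (θ ω) (fun s => w s ω) t := by
  have := (measurable_output hf hu y₀ t).comp
    (hθ.prodMk (measurable_pi_lambda (fun ω t => w (t + 1) ω) hw))
  convert this using 2 with ω
  exact output_congr _ _ fun i _ => rfl

/-- The noise `w_{t+1}` is independent of the parameter and of the outputs up to time `t`. -/
theorem indepFun_stoppedPath_noise (hf : Measurable f) (hu : ∀ t, Measurable (u t))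
    (hθ : Measurable θ) (hw : ∀ t, Measurable (w (t + 1)))
    (hw_indep : iIndepFun (fun t : ℕ => w (t + 1)) μ)
    (hθw : IndepFun θ (fun ω => fun t : ℕ => w (t + 1) ω) μ) (y₀ : ℝ) (t : ℕ) :
    IndepFun (fun ω => (θ ω, stoppedPath (output f u y₀ (θ ω) fun s => w s ω) t)) (w (t + 1)) μ := by
  -- Noise up to time t, padded by zeros: together with θ it determines the outputs up to time t.
  let past : Ω → ℕ → ℝ := fun ω i => if i < t then w (i + 1) ω else 0
  have hpast : Measurable past := measurable_pi_lambda _ fun i => by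
    by_cases hi : i < t
    · simpa only [past, hi, if_true] using hw i
    · simpa only [past, hi, if_false] using measurable_const
  have h1 : IndepFun past (w (t + 1)) μ := by
    have := hw_indep.indepFun_finset (Finset.range t) {t} (by simp) hw
    have hψ : Measurable fun z : ({t} : Finset ℕ) → ℝ => z ⟨t, Finset.mem_singleton_self t⟩ :=
      measurable_pi_apply _
    have hφ : Measurable fun (z : Finset.range t → ℝ) (i : ℕ) =>
        if hi : i < t then z ⟨i, Finset.mem_range.2 hi⟩ else 0 := by
      refine measurable_pi_lambda _ fun i => ?_
      split_ifs <;> fun_prop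
    exact this.comp hφ hψ
  have h2 : IndepFun θ (fun ω => (past ω, w (t + 1) ω)) μ := by
    refine hθw.comp (φ := id) (ψ := fun z : ℕ → ℝ =>
      ((fun i => if i < t then z i else 0 : ℕ → ℝ), z t)) measurable_id ?_
    refine Measurable.prodMk (measurable_pi_lambda _ fun i => ?_) (measurable_pi_apply _)
    split_ifs <;> fun_prop
  have h3 := h2.prodMk_left hθ hpast (hw t) h1
  have h4 := h3.comp (φ := fun p : ℝ × (ℕ → ℝ) =>
    (p.1, stoppedPath (output f u y₀ p.1 fun i => p.2 (i - 1)) t)) (ψ := id)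
    (measurable_fst.prodMk (measurable_pi_lambda _ fun i => measurable_output hf hu y₀ _))
    measurable_id
  rw [Function.id_comp] at h4
  convert h4 using 1
  ext ω : 1
  refine Prod.ext rfl (funext fun i => output_congr _ _ fun j hj => ?_)
  simp [past, show j < t by omega]

theorem lintegral_noise {S : Type*} [MeasurableSpace S] {X : Ω → S} {W : Ω → ℝ} (hX : Measurable X)
    (hW : Measurable W) (hind : IndepFun X W μ) (hlaw : μ.map W = gaussianReal 0 1)
    {F : S × ℝ → ℝ≥0∞} (hF : Measurable F) :
    ∫⁻ ω, F (X ω, W ω) ∂μ = ∫⁻ ω, (∫⁻ v, precPDF 0 1 v * F (X ω, v)) ∂μ := by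
  have h1 := (indepFun_iff_map_prod_eq_prod_map_map hX.aemeasurable hW.aemeasurable).1 hind
  have := Measure.isProbabilityMeasure_map (μ := μ) hX.aemeasurable
  rw [← lintegral_map (g := fun ω => (X ω, W ω)) hF (hX.prodMk hW), h1, hlaw,
    lintegral_prod _ hF.aemeasurable, lintegral_map hF.lintegral_prod_right' hX]
  refine lintegral_congr fun ω => ?_
  rw [lintegral_gaussianReal _ one_ne_zero (by fun_prop)]
  simp

/-- If the posterior law of the parameter at time `t` is Gaussian, so is the joint law of the
parameter and the next output. -/
theorem lintegral_next_output_of_posterior {θ₀ r₀ : ℝ} (hr₀ : 0 < r₀) (hf : Measurable f)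
    (hu : ∀ t, Measurable (u t))
    (hθ : Measurable θ) (hw : ∀ t, Measurable (w (t + 1)))
    (hw_indep : iIndepFun (fun t : ℕ => w (t + 1)) μ)
    (hw_law : ∀ t, μ.map (w (t + 1)) = gaussianReal 0 1)
    (hθw : IndepFun θ (fun ω => fun t : ℕ => w (t + 1) ω) μ) {y₀ : ℝ} {y : Ω → ℕ → ℝ}
    (hy : y = fun ω => output f u y₀ (θ ω) fun s => w s ω) {t : ℕ}
    (hpost : ∀ G : ℝ × (ℕ → ℝ) → ℝ≥0∞, Measurable G →
      ∫⁻ ω, G (θ ω, stoppedPath (y ω) t) ∂μ = ∫⁻ ω, (∫⁻ x,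
        precPDF (postMean f u θ₀ r₀ t (y ω)) (postPrec f r₀ t (y ω)) x *
          G (x, stoppedPath (y ω) t)) ∂μ)
    {F : ℝ × ℝ × (ℕ → ℝ) → ℝ≥0∞} (hF : Measurable F) :
    ∫⁻ ω, F (θ ω, y ω (t + 1), stoppedPath (y ω) t) ∂μ = ∫⁻ ω, (∫⁻ v,
      precPDF (postMean f u θ₀ r₀ t (y ω) * f (y ω t) + u t fun i => y ω i)
        (postPrec f r₀ t (y ω) / postPrec f r₀ (t + 1) (y ω)) v *
      ∫⁻ x, precPDF (postMean f u θ₀ r₀ (t + 1) (extendPath t (y ω) v))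
        (postPrec f r₀ (t + 1) (y ω)) x * F (x, v, stoppedPath (y ω) t)) ∂μ := by
  have hym : Measurable fun ω => stoppedPath (y ω) t := by
    subst hy
    exact measurable_pi_lambda _ fun i => measurable_output_comp hf hu hθ hw y₀ _
  have hum : Measurable fun h : ℕ → ℝ => u t fun i => h i :=
    (hu t).comp (measurable_pi_lambda _ fun i => measurable_pi_apply _)
  have hstep : ∀ ω, y ω (t + 1) = θ ω * f (stoppedPath (y ω) t t)
      + (u t fun i => stoppedPath (y ω) t i) + w (t + 1) ω := by
    intro ω
    have : (fun i : Fin (t + 1) => stoppedPath (y ω) t i) = fun i : Fin (t + 1) => y ω i :=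
      funext fun i => stoppedPath_apply_of_le _ (by omega)
    rw [this, stoppedPath_apply_of_le _ le_rfl, hy]
    exact output_succ ..
  have hind := indepFun_stoppedPath_noise hf hu hθ hw hw_indep hθw y₀ t
  -- Integrate out the fresh noise, replace θ by its posterior law, and let Bayes' formula exchange
  -- the roles of the parameter and the next output.
  have e1 := lintegral_noise (hθ.prodMk hym) (hw t) (by simpa only [hy] using hind) (hw_law t)
    (F := fun p : (ℝ × (ℕ → ℝ)) × ℝ =>
      F (p.1.1, p.1.1 * f (p.1.2 t) + (u t fun i => p.1.2 i) + p.2, p.1.2)) (by fun_prop)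
  simp only [← hstep] at e1
  rw [e1, hpost (fun p => ∫⁻ v, precPDF 0 1 v *
      F (p.1, p.1 * f (p.2 t) + (u t fun i => p.2 i) + v, p.2))]
  · refine lintegral_congr fun ω => ?_
    have hr := postPrec_pos (f := f) hr₀ t (y ω)
    have hui : (fun i : Fin (t + 1) => stoppedPath (y ω) t i) = fun i : Fin (t + 1) => y ω i :=
      funext fun i => stoppedPath_apply_of_le _ (by omega)
    have hb := lintegral_precPDF_bayes (postMean f u θ₀ r₀ t (y ω)) (f (stoppedPath (y ω) t t))
      (u t fun i => stoppedPath (y ω) t i) hr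
      (G := fun p => F (p.1, p.2, stoppedPath (y ω) t)) (by fun_prop)
    refine hb.trans ?_
    rw [hui, stoppedPath_apply_of_le _ le_rfl, ← postPrec_succ]
    refine lintegral_congr fun v => ?_
    congr 1
    refine lintegral_congr fun x => ?_
    congr 2
    have hle : ∀ i ≤ t, extendPath t (y ω) v i = y ω i := fun i hi => if_pos hi
    have hv : extendPath t (y ω) v (t + 1) = v := if_neg (by omega)
    have hue : (fun i : Fin (t + 1) => extendPath t (y ω) v i) = fun i : Fin (t + 1) => y ω i :=
      funext fun i => hle _ (by omega)
    rw [postMean, hue, hv, hle t le_rfl, postMean_congr _ _ hle,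
      postPrec_congr (t := t) _ (fun i hi => hle i hi.le),
      postPrec_congr (t := t + 1) _ (fun i hi => hle i (by omega))]
  · refine Measurable.lintegral_prod_right' (f := fun q : (ℝ × (ℕ → ℝ)) × ℝ => precPDF 0 1 q.2 *
      F (q.1.1, q.1.1 * f (q.1.2 t) + (u t fun i => q.1.2 i) + q.2, q.1.2)) ?_
    refine Measurable.mul (Measurable.precPDF (by fun_prop) (by fun_prop) (by fun_prop)) ?_
    have : Measurable fun q : (ℝ × (ℕ → ℝ)) × ℝ => u t fun i => q.1.2 i :=
      hum.comp (measurable_snd.comp measurable_fst)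
    fun_prop

/-- The posterior law of the parameter, given the outputs up to time `t`, is Gaussian. -/
theorem lintegral_posterior {θ₀ : ℝ} {P₀ : ℝ≥0} (hP₀ : 0 < P₀) (hf : Measurable f)
    (hu : ∀ t, Measurable (u t))
    (hθ : Measurable θ) (hw : ∀ t, Measurable (w (t + 1)))
    (hw_indep : iIndepFun (fun t : ℕ => w (t + 1)) μ)
    (hw_law : ∀ t, μ.map (w (t + 1)) = gaussianReal 0 1) (hθ_law : μ.map θ = gaussianReal θ₀ P₀)
    (hθw : IndepFun θ (fun ω => fun t : ℕ => w (t + 1) ω) μ) {y₀ : ℝ} {y : Ω → ℕ → ℝ}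
    (hy : y = fun ω => output f u y₀ (θ ω) fun s => w s ω) (t : ℕ)
    (G : ℝ × (ℕ → ℝ) → ℝ≥0∞) (hG : Measurable G) :
    ∫⁻ ω, G (θ ω, stoppedPath (y ω) t) ∂μ = ∫⁻ ω, (∫⁻ x,
      precPDF (postMean f u θ₀ (P₀ : ℝ)⁻¹ t (y ω)) (postPrec f (P₀ : ℝ)⁻¹ t (y ω)) x *
        G (x, stoppedPath (y ω) t)) ∂μ := by
  have hr₀ : 0 < (P₀ : ℝ)⁻¹ := by positivity
  induction t generalizing G with
  | zero =>
    have hy0 : ∀ ω, stoppedPath (y ω) 0 = fun _ => y₀ := by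
      intro ω
      ext i
      simp only [stoppedPath, Nat.min_zero, hy, output_zero]
    simp only [hy0, postMean, postPrec, Finset.range_zero, Finset.sum_empty, add_zero,
      lintegral_const, measure_univ, mul_one]
    rw [← lintegral_gaussianReal _ hP₀.ne' (F := fun x => G (x, fun _ => y₀)) (by fun_prop),
      ← hθ_law, lintegral_map (by fun_prop) hθ]
  | succ t ih =>
    have next := @lintegral_next_output_of_posterior _ _ μ _ f u θ w θ₀ _ hr₀ hf hu hθ hw hw_indep
      hw_law hθw y₀ y hy t ih
    -- `K` is the candidate conditional expectation of `G`, as a function of the next output and the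
    -- past. The one-step formula is applied to both `G` and `K`; since `K` ignores the parameter,
    -- its inner Gaussian integrates to 1 and the two results agree.
    let K : ℝ × (ℕ → ℝ) → ℝ≥0∞ := fun p => ∫⁻ x,
      precPDF (postMean f u θ₀ (P₀ : ℝ)⁻¹ (t + 1) (extendPath t p.2 p.1))
        (postPrec f (P₀ : ℝ)⁻¹ (t + 1) p.2) x * G (x, extendPath t p.2 p.1)
    have hext := measurable_extendPath t
    have hK : Measurable K := by
      refine Measurable.lintegral_prod_right' (f := fun q : (ℝ × (ℕ → ℝ)) × ℝ =>
        precPDF (postMean f u θ₀ (P₀ : ℝ)⁻¹ (t + 1) (extendPath t q.1.2 q.1.1))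
        (postPrec f (P₀ : ℝ)⁻¹ (t + 1) q.1.2) q.2 * G (q.2, extendPath t q.1.2 q.1.1)) ?_
      have hm := measurable_postMean hf hu θ₀ (P₀ : ℝ)⁻¹ (t + 1)
      have hp := measurable_postPrec hf (P₀ : ℝ)⁻¹ (t + 1)
      have he : Measurable fun q : (ℝ × (ℕ → ℝ)) × ℝ => extendPath t q.1.2 q.1.1 :=
        hext.comp measurable_fst
      exact Measurable.mul (Measurable.precPDF (by fun_prop) (by fun_prop) (by fun_prop))
        (by fun_prop)
    have e1 := next (F := fun p => G (p.1, extendPath t p.2.2 p.2.1))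
      (hG.comp (measurable_fst.prodMk (hext.comp measurable_snd)))
    have e2 := next (F := fun p => K p.2) (by fun_prop)
    have hS : ∀ ω v, extendPath t (y ω) v = extendPath t (stoppedPath (y ω) t) v := by
      intro ω v
      ext i
      unfold extendPath
      split_ifs with hi
      · rw [stoppedPath_apply_of_le _ hi]
      · rfl
    have hR : ∀ ω, postPrec f (P₀ : ℝ)⁻¹ (t + 1) (y ω) =
        postPrec f (P₀ : ℝ)⁻¹ (t + 1) (stoppedPath (y ω) t) := fun ω =>
      postPrec_congr _ fun i hi => (stoppedPath_apply_of_le _ (by omega)).symm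
    simp only [extendPath_stoppedPath] at e1
    rw [e1]
    have e3 : ∀ ω, K (y ω (t + 1), stoppedPath (y ω) t) = ∫⁻ x,
        precPDF (postMean f u θ₀ (P₀ : ℝ)⁻¹ (t + 1) (y ω))
          (postPrec f (P₀ : ℝ)⁻¹ (t + 1) (y ω)) x * G (x, stoppedPath (y ω) (t + 1)) := by
      intro ω
      simp only [K]
      rw [extendPath_stoppedPath, ← hR, postMean_congr (y := stoppedPath (y ω) (t + 1)) (z := y ω)
        _ _ fun i hi => stoppedPath_apply_of_le _ hi]
    simp only [e3] at e2
    rw [e2]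
    refine lintegral_congr fun ω => lintegral_congr fun v => ?_
    congr 1
    rw [lintegral_mul_const _ (Measurable.precPDF (by fun_prop) (by fun_prop) (by fun_prop)),
      lintegral_precPDF _ (postPrec_pos hr₀ _ _), one_mul]
    simp only [K, hS, hR]

/-- Given the outputs up to time `t`, the next output is Gaussian with variance
`postPrec (t + 1) / postPrec t`. -/
theorem lintegral_next_output {θ₀ : ℝ} {P₀ : ℝ≥0} (hP₀ : 0 < P₀) (hf : Measurable f)
    (hu : ∀ t, Measurable (u t))
    (hθ : Measurable θ) (hw : ∀ t, Measurable (w (t + 1)))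
    (hw_indep : iIndepFun (fun t : ℕ => w (t + 1)) μ)
    (hw_law : ∀ t, μ.map (w (t + 1)) = gaussianReal 0 1) (hθ_law : μ.map θ = gaussianReal θ₀ P₀)
    (hθw : IndepFun θ (fun ω => fun t : ℕ => w (t + 1) ω) μ) {y₀ : ℝ} {y : Ω → ℕ → ℝ}
    (hy : y = fun ω => output f u y₀ (θ ω) fun s => w s ω) (t : ℕ)
    {F : ℝ × (ℕ → ℝ) → ℝ≥0∞} (hF : Measurable F) :
    ∫⁻ ω, F (y ω (t + 1), stoppedPath (y ω) t) ∂μ = ∫⁻ ω, (∫⁻ v,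
      precPDF (postMean f u θ₀ (P₀ : ℝ)⁻¹ t (y ω) * f (y ω t) + u t fun i => y ω i)
        (postPrec f (P₀ : ℝ)⁻¹ t (y ω) / postPrec f (P₀ : ℝ)⁻¹ (t + 1) (y ω)) v *
      F (v, stoppedPath (y ω) t)) ∂μ := by
  have hr₀ : 0 < (P₀ : ℝ)⁻¹ := by positivity
  rw [lintegral_next_output_of_posterior hr₀ hf hu hθ hw hw_indep hw_law hθw hy
    (lintegral_posterior hP₀ hf hu hθ hw hw_indep hw_law hθ_law hθw hy t)
    (F := fun p => F p.2) (by fun_prop)]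
  refine lintegral_congr fun ω => lintegral_congr fun v => ?_
  dsimp only
  rw [lintegral_mul_const _ (Measurable.precPDF (by fun_prop) (by fun_prop) (by fun_prop)),
    lintegral_precPDF _ (postPrec_pos hr₀ _ _), one_mul]

end

/-! ### Growth of the precision -/

/-- The supremum over `x ≥ exp (2 ^ (n + 1))` of `x ^ (-1 / (16 (n + 1)²)) * g x`. -/
noncomputable def tailRatio (h : ℝ → ℝ) (n : ℕ) : ℝ≥0∞ :=
  ⨆ x ∈ Set.Ici (Real.exp (2 ^ (n + 1))),
    ENNReal.ofReal (x ^ (-(1 / (16 * ((n : ℝ) + 1) ^ 2)))) * invRatio h x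

/-- This turns the series hypothesis into a usable inverse of h: x ≤ h⁻¹(z) = z^(1/4) g(z), and the
n-th supremum controls g(z). It is applied with z = √r''. -/
theorem le_tailRatio_mul_rpow {h : ℝ → ℝ} {n : ℕ} (hc : tailRatio h n ≠ ⊤) {x z : ℝ} (hx : 0 ≤ x)
    (hz : Real.exp (2 ^ (n + 1)) ≤ z) (hxz : h x ≤ z) :
    x ≤ (tailRatio h n).toReal * z ^ (1 / 4 + 1 / (16 * ((n : ℝ) + 1) ^ 2)) := by
  have hz0 : 0 < z := (Real.exp_pos _).trans_le hz
  have h1 : ENNReal.ofReal x ≤ genInverse h |z| := by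
    rw [abs_of_pos hz0]
    exact le_iSup₂_of_le x ⟨hx, hxz⟩ le_rfl
  have h2 : ENNReal.ofReal (z ^ (-(1 / (16 * ((n : ℝ) + 1) ^ 2)))) *
      (ENNReal.ofReal (|z| ^ (-(1 / 4) : ℝ)) * ENNReal.ofReal x) ≤ tailRatio h n := by
    refine le_trans ?_ (le_iSup₂_of_le (f := fun x _ =>
      ENNReal.ofReal (x ^ (-(1 / (16 * ((n : ℝ) + 1) ^ 2)))) * invRatio h x) z hz le_rfl)
    rw [invRatio]
    gcongr
  rw [← ENNReal.ofReal_mul (by positivity), ← ENNReal.ofReal_mul (by positivity),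
    ENNReal.ofReal_le_iff_le_toReal hc, abs_of_pos hz0, ← mul_assoc, ← Real.rpow_add hz0,
    show -(1 / (16 * ((n : ℝ) + 1) ^ 2)) + -(1 / 4) = -(1 / 4 + 1 / (16 * ((n : ℝ) + 1) ^ 2)) by
      ring, Real.rpow_neg hz0.le, inv_mul_le_iff₀ (by positivity), mul_comm] at h2
  exact h2

/-- One step of the growth recursion for `log r_t`, a discrete Euler equation with critical
potential: the lower bound `x_{n+1} / x_n ≥ 2 n / (2 n - 1)` for `x_n = 2 ^ (-n) log r_n`
propagates. -/
theorem log_growth_step {n A B C : ℝ} (hn : 1 ≤ n) (hC : 0 ≤ C)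
    (hAB : 4 * n * A ≤ (2 * n - 1) * B)
    (hABC : B - A ≤ (1 / 4 + 1 / (16 * (n + 1) ^ 2)) * C) :
    4 * (n + 1) * B ≤ (2 * n + 1) * C := by
  have h1 : (2 * n + 1) * B ≤ 4 * n * ((1 / 4 + 1 / (16 * (n + 1) ^ 2)) * C) := by nlinarith
  -- The constant 16 is what makes this work: the left side is (2n+1)² - 1 + n/(n+1), and a
  -- coefficient above 1/16 would fail for large n.
  have h2 : 4 * (n + 1) * (4 * n * (1 / 4 + 1 / (16 * (n + 1) ^ 2))) ≤ (2 * n + 1) ^ 2 := by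
    have : 4 * (n + 1) * (4 * n * (1 / 4 + 1 / (16 * (n + 1) ^ 2))) =
        4 * n * (n + 1) + n / (n + 1) := by
      field_simp
      ring
    rw [this]
    have : n / (n + 1) ≤ 1 := (div_le_one (by linarith)).2 (by linarith)
    nlinarith
  have h3 : (2 * n + 1) * (4 * (n + 1) * B) ≤ (2 * n + 1) * ((2 * n + 1) * C) := by
    calc (2 * n + 1) * (4 * (n + 1) * B) = 4 * (n + 1) * ((2 * n + 1) * B) := by ring
      _ ≤ 4 * (n + 1) * (4 * n * ((1 / 4 + 1 / (16 * (n + 1) ^ 2)) * C)) := by gcongr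
      _ = (4 * (n + 1) * (4 * n * (1 / 4 + 1 / (16 * (n + 1) ^ 2)))) * C := by ring
      _ ≤ (2 * n + 1) ^ 2 * C := by gcongr
      _ = _ := by ring
  exact le_of_mul_le_mul_left h3 (by linarith)

/-- The precision growth invariant, for consecutive precisions `r` and `r'`. -/
def FastGrowth (n : ℕ) (r r' : ℝ) : Prop :=
  2 ^ (n + 2) ≤ Real.log r' ∧ 4 * (n : ℝ) * Real.log r ≤ (2 * n - 1) * Real.log r'

/-- The second part of the invariant gives log r ≤ (log r')/2, so log √(r'/r) ≥ (log r')/4. -/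
theorem FastGrowth.two_pow_le_log_sqrt {n : ℕ} (hn : 1 ≤ n) {r r' : ℝ} (hr : 0 < r) (hr' : 0 < r')
    (hg : FastGrowth n r r') : 2 ^ n ≤ Real.log √(r' / r) := by
  obtain ⟨h1, h2⟩ := hg
  have hn' : (1 : ℝ) ≤ n := by exact_mod_cast hn
  have hB : 0 ≤ Real.log r' := le_trans (by positivity) h1
  rw [Real.log_sqrt (by positivity), Real.log_div hr'.ne' hr.ne']
  have h3 : 4 * (n : ℝ) * Real.log r ≤ 4 * n * (Real.log r' / 2) := by nlinarith
  have h4 := le_of_mul_le_mul_left h3 (by positivity)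
  rw [pow_add] at h1
  linarith

/-- Outside the slow set f(y)² ≥ h(|y|)², so a large output forces a large next precision; comparing
logarithms yields the recursion of `log_growth_step`. -/
theorem FastGrowth.step {f h : ℝ → ℝ} {n : ℕ} (hn : 1 ≤ n) (hc : tailRatio h n ≠ ⊤) {r r' y ε : ℝ}
    (hr : 0 < r) (hr' : 0 < r') (hg : FastGrowth n r r') (hε : 0 < ε)
    (hcε : (tailRatio h n).toReal ≤ ε) (hy : ε * √(r' / r) < |y|) (hyS : y ∉ slowSet f h) :
    FastGrowth (n + 1) r' (r' + f y ^ 2) := by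
  obtain ⟨h1, h2⟩ := hg
  have hn' : (1 : ℝ) ≤ n := by exact_mod_cast hn
  set r'' := r' + f y ^ 2 with hr''
  have hr''0 : 0 < r'' := by positivity
  have hlog : Real.log r' ≤ Real.log r'' := Real.log_le_log hr' (by simp [hr'', sq_nonneg])
  have hC0 : 0 ≤ Real.log r'' := (le_trans (by positivity) h1).trans hlog
  have hz0 : 0 < √r'' := by positivity
  have hfz : h |y| ≤ √r'' := by
    refine (not_lt.1 hyS).trans ?_
    rw [← Real.sqrt_sq_eq_abs]
    exact Real.sqrt_le_sqrt (by linarith)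
  have hz : Real.exp (2 ^ (n + 1)) ≤ √r'' := by
    rw [← Real.le_log_iff_exp_le hz0, Real.log_sqrt hr''0.le]
    have : (2 : ℝ) ^ (n + 2) = 2 * 2 ^ (n + 1) := by ring
    linarith
  have key := le_tailRatio_mul_rpow hc (abs_nonneg y) hz hfz
  -- The threshold ε is at least the constant of the inverse bound, so the two cancel.
  have hσ : √(r' / r) ≤ √r'' ^ (1 / 4 + 1 / (16 * ((n : ℝ) + 1) ^ 2)) := by
    refine le_of_mul_le_mul_left ((hy.le.trans key).trans ?_) hε
    gcongr
  have hl := Real.log_le_log (by positivity) hσ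
  rw [Real.log_rpow hz0, Real.log_sqrt hr''0.le, Real.log_sqrt (by positivity),
    Real.log_div hr'.ne' hr.ne'] at hl
  have h3 : 4 * ((n : ℝ) + 1) * Real.log r' ≤ (2 * n + 1) * Real.log r'' :=
    log_growth_step hn' hC0 h2 (by linarith)
  have h4 : (2 * (n : ℝ) + 1) * (2 * Real.log r') ≤ (2 * n + 1) * Real.log r'' := by
    have : 0 ≤ Real.log r' := le_trans (by positivity) h1
    linarith
  have h5 := le_of_mul_le_mul_left h4 (by positivity)
  refine ⟨?_, ?_⟩
  · have : (2 : ℝ) ^ (n + 1 + 2) = 2 * 2 ^ (n + 2) := by ring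
    linarith
  · push_cast
    linarith

/-! ### Consequences of sparsity, and divergence of the mean squares -/

theorem exists_forall_density_le {S : Set ℝ} {δ : ℝ}
    (h_sparse : (fun l : ℝ => ⨆ x : ℝ, (volume (S ∩ Set.Icc (x - l) (x + l))).toReal / l)
      =O[atTop] fun l : ℝ => 1 / Real.log (Real.log l) ^ (1 + δ)) :
    ∃ C l₀ : ℝ, 0 < C ∧ ∀ l, l₀ ≤ l → ∀ z, volume (S ∩ Set.Icc (z - l) (z + l)) ≤
      ENNReal.ofReal (C / Real.log (Real.log l) ^ (1 + δ) * l) := by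
  obtain ⟨C, hC, hbound⟩ := h_sparse.exists_pos
  obtain ⟨l₀, hl₀⟩ := eventually_atTop.1 (hbound.bound.and ((eventually_gt_atTop (0 : ℝ)).and
    ((Real.tendsto_log_atTop.comp Real.tendsto_log_atTop).eventually_ge_atTop 0)))
  refine ⟨C, l₀, hC, fun l hl z => ?_⟩
  obtain ⟨h1, h2, h3⟩ := hl₀ l hl
  have hvol : ∀ x, volume (S ∩ Set.Icc (x - l) (x + l)) ≤ ENNReal.ofReal (2 * l) := fun x => by
    refine (measure_mono Set.inter_subset_right).trans (le_of_eq ?_)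
    rw [Real.volume_Icc]
    congr 1
    ring
  -- Boundedness makes the real-valued supremum a genuine one rather than the default value 0.
  have hbdd : BddAbove (Set.range fun x : ℝ =>
      (volume (S ∩ Set.Icc (x - l) (x + l))).toReal / l) := by
    refine ⟨2, ?_⟩
    rintro _ ⟨x, rfl⟩
    dsimp only
    rw [div_le_iff₀ h2]
    exact ENNReal.toReal_le_of_le_ofReal (by positivity) (hvol x)
  have h4 := (le_ciSup hbdd z).trans ((le_abs_self _).trans h1)
  rw [ENNReal.le_ofReal_iff_toReal_le (ne_top_of_le_ne_top ENNReal.ofReal_ne_top (hvol z))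
    (by have : 0 ≤ Real.log (Real.log l) := h3
        positivity), ← div_le_iff₀ h2]
  refine h4.trans (le_of_eq ?_)
  have : 0 ≤ Real.log (Real.log l) := h3
  rw [Real.norm_of_nonneg (by positivity), mul_one_div]

/-- The system function is unbounded when its slow set is sparse. -/
theorem exists_le_abs_of_sparse {f h : ℝ → ℝ} {δ : ℝ} (hδ : 0 < δ) {n : ℕ}
    (hc : tailRatio h n ≠ ⊤)
    (h_sparse : (fun l : ℝ =>
        ⨆ x : ℝ, (volume (slowSet f h ∩ Set.Icc (x - l) (x + l))).toReal / l)
      =O[atTop] fun l : ℝ => 1 / Real.log (Real.log l) ^ (1 + δ)) (M : ℝ) :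
    ∃ y, M ≤ |f y| := by
  obtain ⟨C, l₀, hC, hd⟩ := exists_forall_density_le h_sparse
  set z := max M (Real.exp (2 ^ (n + 1))) with hz
  set X := (tailRatio h n).toReal * z ^ (1 / 4 + 1 / (16 * ((n : ℝ) + 1) ^ 2)) with hX
  have hX0 : 0 ≤ X := by positivity
  have hlim : Tendsto (fun l : ℝ => C / Real.log (Real.log l) ^ (1 + δ)) atTop (nhds 0) :=
    tendsto_const_nhds.div_atTop ((tendsto_rpow_atTop (by linarith)).comp
      (Real.tendsto_log_atTop.comp Real.tendsto_log_atTop))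
  obtain ⟨l, hl1, hl2, hl0⟩ := ((hlim.eventually_le_const one_pos).and
    ((eventually_ge_atTop l₀).and (eventually_gt_atTop 0))).exists
  -- A window of length 2l to the right of X cannot be covered by a set of measure at most l.
  obtain ⟨y, hy, hyS⟩ : ∃ y ∈ Set.Icc (X + 1 + l - l) (X + 1 + l + l), y ∉ slowSet f h := by
    by_contra! hcon
    have := (hd l hl2 (X + 1 + l)).trans
      (ENNReal.ofReal_le_ofReal (mul_le_mul_of_nonneg_right hl1 hl0.le))
    rw [Set.inter_eq_right.2 hcon, Real.volume_Icc, ENNReal.ofReal_le_ofReal_iff (by positivity)]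
      at this
    linarith
  refine ⟨y, ?_⟩
  by_contra! hlt
  have hy0 : X < y := by linarith [hy.1]
  have := le_tailRatio_mul_rpow hc (abs_nonneg y) (le_max_right M _)
    ((not_lt.1 hyS).trans (hlt.le.trans (le_max_left _ _)))
  exact absurd this (not_le.2 (hy0.trans_le (le_abs_self y)))

theorem measurableSet_slowSet {f h : ℝ → ℝ} (hf : Measurable f) (h_mono : MonotoneOn h (Set.Ici 0)) :
    MeasurableSet (slowSet f h) := by
  have h1 : Monotone fun x => h (max x 0) := fun x y hxy =>
    h_mono (Set.mem_Ici.2 (le_max_right _ _)) (Set.mem_Ici.2 (le_max_right _ _))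
      (max_le_max_right 0 hxy)
  have h2 : Measurable fun x : ℝ => h |x| := by
    have := h1.measurable.comp (measurable_id.abs : Measurable fun x : ℝ => |x|)
    simpa [Function.comp_def] using this
  exact measurableSet_lt hf.abs h2

/-- A sequence whose terms grow doubly exponentially has infinite mean squares. -/
theorem limsup_mean_sq_eq_top {y : ℕ → ℝ} {T : ℕ}
    (hy : ∀ s, ((2 : ℝ)⁻¹) ^ (T + s) * Real.exp (2 ^ (T + s)) ≤ |y (s + 1)|) :
    limsup (fun t : ℕ => (((1 / (t : ℝ)) * ∑ i ∈ Finset.Icc 1 t, y i ^ 2 : ℝ) : EReal)) atTop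
      = ⊤ := by
  have hreal : Tendsto (fun t : ℕ => (1 / (t : ℝ)) * ∑ i ∈ Finset.Icc 1 t, y i ^ 2)
      atTop atTop := by
    rw [← tendsto_add_atTop_iff_nat 1]
    have h2 : Tendsto (fun s : ℕ => (2 : ℝ) ^ s / 4) atTop atTop :=
      (tendsto_pow_atTop_atTop_of_one_lt (by norm_num)).atTop_div_const (by norm_num)
    refine tendsto_atTop_mono (fun s => ?_) h2
    have hv1 : (2 : ℝ) ^ s ≤ 2 ^ (T + s) := pow_le_pow_right₀ (by norm_num) (by omega)
    have hs : ((s : ℝ) + 1) ≤ 2 ^ s := by exact_mod_cast Nat.lt_two_pow_self (n := s)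
    have h3 : (2 : ℝ) ^ s / 2 ≤ |y (s + 1)| := by
      refine le_trans ?_ (hy s)
      have hv0 : (0 : ℝ) < 2 ^ (T + s) := by positivity
      have := Real.quadratic_le_exp_of_nonneg hv0.le
      rw [inv_pow]
      calc (2 : ℝ) ^ s / 2 ≤ 2 ^ (T + s) / 2 := by gcongr
        _ = (2 ^ (T + s))⁻¹ * ((2 ^ (T + s)) ^ 2 / 2) := by field_simp
        _ ≤ _ := by
          gcongr
          linarith
    -- The last square alone, at least 4^s / 4, beats the number s + 1 ≤ 2^s of terms.
    have h4 : ((2 : ℝ) ^ s / 2) ^ 2 ≤ ∑ i ∈ Finset.Icc 1 (s + 1), y i ^ 2 := by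
      refine le_trans ?_ (Finset.single_le_sum (f := fun i => y i ^ 2)
        (fun i _ => sq_nonneg _) (Finset.mem_Icc.2 ⟨by omega, le_refl (s + 1)⟩))
      rw [← sq_abs (y (s + 1))]
      gcongr
    rw [one_div, inv_mul_eq_div, le_div_iff₀ (by positivity)]
    push_cast
    refine le_trans ?_ h4
    have : (0 : ℝ) < 2 ^ s := by positivity
    nlinarith
  exact (EReal.tendsto_coe_nhds_top_iff.2 hreal).limsup_eq

/-! ### One bad step, and the union bound -/

section
variable {Ω : Type*} [MeasurableSpace Ω] {μ : Measure Ω} [IsProbabilityMeasure μ]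
  {f : ℝ → ℝ} {u : (t : ℕ) → (Fin (t + 1) → ℝ) → ℝ} {θ : Ω → ℝ} {w : ℕ → Ω → ℝ}

/-- The probability that the next output is small compared with its conditional standard deviation,
or lies in a sparse set, while the past outputs lie in `A`. -/
theorem measure_next_output_le {θ₀ : ℝ} {P₀ : ℝ≥0} (hP₀ : 0 < P₀) (hf : Measurable f)
    (hu : ∀ t, Measurable (u t))
    (hθ : Measurable θ) (hw : ∀ t, Measurable (w (t + 1)))
    (hw_indep : iIndepFun (fun t : ℕ => w (t + 1)) μ)
    (hw_law : ∀ t, μ.map (w (t + 1)) = gaussianReal 0 1) (hθ_law : μ.map θ = gaussianReal θ₀ P₀)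
    (hθw : IndepFun θ (fun ω => fun t : ℕ => w (t + 1) ω) μ) {y₀ : ℝ} {y : Ω → ℕ → ℝ}
    (hy : y = fun ω => output f u y₀ (θ ω) fun s => w s ω) (t : ℕ)
    {σ : (ℕ → ℝ) → ℝ}
    (hσ : σ = fun p => √(postPrec f (P₀ : ℝ)⁻¹ (t + 1) p / postPrec f (P₀ : ℝ)⁻¹ t p))
    {A : Set (ℕ → ℝ)} (hA : MeasurableSet A) {S : Set ℝ} (hS : MeasurableSet S) {ε b : ℝ}
    (hb : ∀ p ∈ A, ∀ z, volume (S ∩ Set.Icc (z - σ p) (z + σ p)) ≤ ENNReal.ofReal (b * σ p)) :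
    MeasurableSet {ω | stoppedPath (y ω) t ∈ A ∧
      (|y ω (t + 1)| ≤ ε * σ (stoppedPath (y ω) t) ∨ y ω (t + 1) ∈ S)} ∧
    μ {ω | stoppedPath (y ω) t ∈ A ∧
      (|y ω (t + 1)| ≤ ε * σ (stoppedPath (y ω) t) ∨ y ω (t + 1) ∈ S)} ≤
      ENNReal.ofReal ε + ENNReal.ofReal (2 * b) := by
  have hr₀ : 0 < (P₀ : ℝ)⁻¹ := by positivity
  have hσm : Measurable σ := by
    have h1 := measurable_postPrec hf (P₀ : ℝ)⁻¹ t
    have h2 := measurable_postPrec hf (P₀ : ℝ)⁻¹ (t + 1)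
    rw [hσ]
    fun_prop
  let B : Set (ℝ × (ℕ → ℝ)) := {q | q.2 ∈ A ∧ (|q.1| ≤ ε * σ q.2 ∨ q.1 ∈ S)}
  have hB : MeasurableSet B := by
    have h1 : MeasurableSet {q : ℝ × (ℕ → ℝ) | |q.1| ≤ ε * σ q.2} :=
      measurableSet_le (by fun_prop) (by fun_prop)
    exact (measurable_snd hA).inter (h1.union (measurable_fst hS))
  have hYm : Measurable fun ω => (y ω (t + 1), stoppedPath (y ω) t) := by
    subst hy
    exact (measurable_output_comp hf hu hθ hw y₀ _).prodMk
      (measurable_pi_lambda _ fun i => measurable_output_comp hf hu hθ hw y₀ _)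
  refine ⟨hYm hB, ?_⟩
  change μ ((fun ω => (y ω (t + 1), stoppedPath (y ω) t)) ⁻¹' B) ≤ _
  rw [← lintegral_indicator_one (hYm hB)]
  have hnext := lintegral_next_output hP₀ hf hu hθ hw hw_indep hw_law hθ_law hθw hy t
    (F := B.indicator 1) (measurable_one.indicator hB)
  refine (hnext.le).trans ?_
  refine (lintegral_mono (g := fun _ => ENNReal.ofReal ε + ENNReal.ofReal (2 * b))
    fun ω => ?_).trans (by simp)
  dsimp only
  set p := stoppedPath (y ω) t
  have hp1 : postPrec f (P₀ : ℝ)⁻¹ t (y ω) = postPrec f (P₀ : ℝ)⁻¹ t p :=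
    postPrec_congr _ fun i hi => (stoppedPath_apply_of_le _ (by omega)).symm
  have hp2 : postPrec f (P₀ : ℝ)⁻¹ (t + 1) (y ω) = postPrec f (P₀ : ℝ)⁻¹ (t + 1) p :=
    postPrec_congr _ fun i hi => (stoppedPath_apply_of_le _ (by omega)).symm
  have hr1 := postPrec_pos (f := f) hr₀ t p
  have hr2 := postPrec_pos (f := f) hr₀ (t + 1) p
  have hσ0 : 0 < σ p := by
    rw [hσ]
    positivity
  have hprec : postPrec f (P₀ : ℝ)⁻¹ t (y ω) / postPrec f (P₀ : ℝ)⁻¹ (t + 1) (y ω) =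
      (σ p ^ 2)⁻¹ := by
    rw [hp1, hp2, hσ, Real.sq_sqrt (by positivity), inv_div]
  rw [hprec]
  -- The control enters the conditional law only through its mean, and both Gaussian estimates are
  -- uniform in the mean.
  generalize postMean f u θ₀ (P₀ : ℝ)⁻¹ t (y ω) * f (y ω t) + (u t fun i => y ω i) = m
  by_cases hpA : p ∈ A
  · have hset : ∀ v, precPDF m (σ p ^ 2)⁻¹ v * B.indicator 1 (v, p) =
        (Set.Icc (-(ε * σ p)) (ε * σ p) ∪ S).indicator (precPDF m (σ p ^ 2)⁻¹) v := by
      intro v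
      by_cases hv : (v, p) ∈ B
      · have : v ∈ Set.Icc (-(ε * σ p)) (ε * σ p) ∪ S := hv.2.imp abs_le.1 id
        simp [hv, this]
      · have : v ∉ Set.Icc (-(ε * σ p)) (ε * σ p) ∪ S := fun h =>
          hv ⟨hpA, h.imp abs_le.2 id⟩
        rw [Set.indicator_of_notMem hv, Set.indicator_of_notMem this, mul_zero]
    simp_rw [hset]
    rw [lintegral_indicator (measurableSet_Icc.union hS)]
    refine (lintegral_union_le _ _ _).trans (add_le_add (lintegral_precPDF_Icc_le m ε hσ0) ?_)
    exact lintegral_precPDF_le_of_density m hσ0 (hb p hpA)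
  · have hzero : ∀ v, precPDF m (σ p ^ 2)⁻¹ v * B.indicator 1 (v, p) = 0 := fun v => by
      rw [Set.indicator_of_notMem (fun h => hpA h.1), mul_zero]
    simp [hzero]

end

theorem theorem2p4 {Ω : Type*} [MeasurableSpace Ω] (μ : Measure Ω) [IsProbabilityMeasure μ]
    -- the system function, the parameter and the noise
    (f : ℝ → ℝ) (hf : PiecewiseContinuousOn f Set.univ)
    (θ : Ω → ℝ) (w : ℕ → Ω → ℝ)
    (hw_meas : ∀ t, Measurable (w (t + 1)))
    (hw_indep : iIndepFun (fun t : ℕ => w (t + 1)) μ)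
    (hw_law : ∀ t, μ.map (w (t + 1)) = gaussianReal 0 1)
    (θ₀ : ℝ) (P₀ : ℝ≥0) (hP₀ : 0 < P₀)
    (hθ_meas : Measurable θ)
    (hθ_law : μ.map θ = gaussianReal θ₀ P₀)
    (hθw : IndepFun θ (fun ω => fun t : ℕ => w (t + 1) ω) μ)
    -- the comparison function `h : [0, ∞) → [0, ∞)`
    (h : ℝ → ℝ) (h_nonneg : ∀ x, 0 ≤ x → 0 ≤ h x)
    (h_mono : MonotoneOn h (Set.Ici 0))
    (h_pc : PiecewiseContinuousOn h (Set.Ici 0))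
    (h_growth : h =O[atTop] fun x : ℝ => x ^ 4 + 1)
    -- the sum over `t ≥ 1` (shifted by one) of `sup_{x ≥ e^{2^t}} x^{-1/(16 t²)} g(x)` is finite
    (h_sum : ∑' t : ℕ, (⨆ x ∈ Set.Ici (Real.exp (2 ^ (t + 1))),
      ENNReal.ofReal (x ^ (-(1 / (16 * ((t : ℝ) + 1) ^ 2)))) * invRatio h x) < ⊤)
    (δ : ℝ) (hδ : 0 < δ)
    (h_sparse : (fun l : ℝ =>
        ⨆ x : ℝ, (volume (slowSet f h ∩ Set.Icc (x - l) (x + l))).toReal / l)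
      =O[atTop] fun l : ℝ => 1 / Real.log (Real.log l) ^ (1 + δ)) :
    Unstabilizable μ f θ w := by
  intro u hu
  have hfm := hf.measurable
  have hSm : MeasurableSet (slowSet f h) := measurableSet_slowSet hfm h_mono
  have hsum : ∑' n, tailRatio h n ≠ ⊤ := h_sum.ne
  have hc : ∀ n, tailRatio h n ≠ ⊤ := ENNReal.ne_top_of_tsum_ne_top hsum
  obtain ⟨C, l₀, hC, hdens⟩ := exists_forall_density_le h_sparse
  -- The first summand lets the growth step cancel its constant; the second keeps ε positive and
  -- bounds the outputs from below even when the first vanishes.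
  let ε : ℕ → ℝ := fun n => (tailRatio h n).toReal + 2⁻¹ ^ n
  let b : ℕ → ℝ := fun n => C / ((n : ℝ) * Real.log 2) ^ (1 + δ)
  have htail : ∑' n, (ENNReal.ofReal (ε n) + ENNReal.ofReal (2 * b n)) ≠ ⊤ := by
    rw [ENNReal.tsum_add]
    refine ENNReal.add_ne_top.2 ⟨?_, ?_⟩
    · exact ((ENNReal.summable_toReal hsum).add
        (summable_geometric_of_lt_one (by norm_num) (by norm_num))).tsum_ofReal_ne_top
    · refine Summable.tsum_ofReal_ne_top ?_
      have h1 : Summable fun n : ℕ => 1 / (n : ℝ) ^ (1 + δ) :=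
        Real.summable_one_div_nat_rpow.2 (by linarith)
      refine (h1.mul_left (2 * (C / Real.log 2 ^ (1 + δ)))).congr fun n => ?_
      simp only [b]
      rw [Real.mul_rpow (by positivity) (by positivity)]
      ring
  -- The last condition puts every σ ≥ exp(2^T) above the scale `l₀` from which the density bound
  -- holds.
  obtain ⟨T, hT1, hT, hTl⟩ : ∃ T : ℕ, 1 ≤ T ∧
      ∑' s, (ENNReal.ofReal (ε (s + T)) + ENNReal.ofReal (2 * b (s + T))) < 1 ∧
      Real.log (max l₀ 1) ≤ 2 ^ T :=
    ((eventually_ge_atTop 1).and (((ENNReal.tendsto_sum_nat_add _ htail).eventually_lt_const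
      one_pos).and ((tendsto_pow_atTop_atTop_of_one_lt
        (by norm_num : (1 : ℝ) < 2)).eventually_ge_atTop _))).exists
  set r₀ : ℝ := (P₀ : ℝ)⁻¹ with hr₀_def
  have hr₀ : 0 < r₀ := by positivity
  -- The first summand of the exponent gives the size condition at time 0; the second gives the
  -- ratio condition, whatever the sign of log r₀.
  obtain ⟨y₀, hy₀⟩ := exists_le_abs_of_sparse hδ (hc 0) h_sparse
    (Real.exp (2 ^ (T + 2) + 4 * T * |Real.log r₀|))
  have hbase : FastGrowth T r₀ (r₀ + f y₀ ^ 2) := by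
    have h1 : 2 ^ (T + 2) + 4 * T * |Real.log r₀| ≤ Real.log (r₀ + f y₀ ^ 2) := by
      rw [Real.le_log_iff_exp_le (by positivity), ← sq_abs (f y₀)]
      have : (1 : ℝ) ≤ Real.exp (2 ^ (T + 2) + 4 * T * |Real.log r₀|) :=
        Real.one_le_exp (by positivity)
      nlinarith
    have h2 : 0 ≤ 4 * (T : ℝ) * |Real.log r₀| := by positivity
    have h3 : (0 : ℝ) < 2 ^ (T + 2) := by positivity
    have hT1' : (1 : ℝ) ≤ T := by exact_mod_cast hT1
    refine ⟨by linarith, ?_⟩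
    have h4 : 4 * (T : ℝ) * Real.log r₀ ≤ 4 * T * |Real.log r₀| := by
      gcongr
      exact le_abs_self _
    nlinarith
  set y : Ω → ℕ → ℝ := fun ω => output f u y₀ (θ ω) fun s => w s ω with hy
  let σ : ℕ → (ℕ → ℝ) → ℝ := fun s p => √(postPrec f r₀ (s + 1) p / postPrec f r₀ s p)
  let A : ℕ → Set (ℕ → ℝ) := fun s =>
    {p | FastGrowth (s + T) (postPrec f r₀ s p) (postPrec f r₀ (s + 1) p)}
  have hA : ∀ s, MeasurableSet (A s) := fun s => by
    have h1 := measurable_postPrec hfm r₀ s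
    have h2 := measurable_postPrec hfm r₀ (s + 1)
    exact (measurableSet_le measurable_const h2.log).inter
      (measurableSet_le (h1.log.const_mul _) (h2.log.const_mul _))
  have hlogσ : ∀ s, ∀ p ∈ A s, 2 ^ (s + T) ≤ Real.log (σ s p) := fun s p hp =>
    FastGrowth.two_pow_le_log_sqrt (by omega) (postPrec_pos hr₀ _ _) (postPrec_pos hr₀ _ _) hp
  have hσ0 : ∀ s p, 0 < σ s p := fun s p => by
    have h1 := postPrec_pos (f := f) hr₀ s p
    have h2 := postPrec_pos (f := f) hr₀ (s + 1) p
    simp only [σ]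
    positivity
  -- The invariant is part of the bad event, so each event needs only a one-step conditional bound,
  -- and the union bound needs no independence.
  let bad : ℕ → Set Ω := fun s => {ω | stoppedPath (y ω) s ∈ A s ∧
    (|y ω (s + 1)| ≤ ε (s + T) * σ s (stoppedPath (y ω) s) ∨ y ω (s + 1) ∈ slowSet f h)}
  have hbad : ∀ s, MeasurableSet (bad s) ∧
      μ (bad s) ≤ ENNReal.ofReal (ε (s + T)) + ENNReal.ofReal (2 * b (s + T)) := fun s => by
    refine measure_next_output_le hP₀ hfm hu hθ_meas hw_meas hw_indep hw_law hθ_law hθw hy s rfl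
      (hA s) hSm fun p hp z => ?_
    have h1 := hlogσ s p hp
    have hl : l₀ ≤ σ s p := by
      have h2 : Real.log (max l₀ 1) ≤ Real.log (σ s p) :=
        (hTl.trans (pow_le_pow_right₀ (by norm_num) (by omega))).trans h1
      exact (le_max_left _ _).trans
        ((Real.log_le_log_iff (lt_max_of_lt_right one_pos) (hσ0 s p)).1 h2)
    refine (hdens _ hl z).trans (ENNReal.ofReal_le_ofReal ?_)
    have h3 : ((s + T : ℕ) : ℝ) * Real.log 2 ≤ Real.log (Real.log (σ s p)) := by
      rw [← Real.log_pow]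
      exact Real.log_le_log (by positivity) h1
    have h4 : 0 < ((s + T : ℕ) : ℝ) * Real.log 2 :=
      mul_pos (by exact_mod_cast (by omega : 0 < s + T)) (Real.log_pos (by norm_num))
    have := hσ0 s p
    simp only [b]
    gcongr
  have hunion : μ (⋃ s, bad s) < 1 :=
    ((measure_iUnion_le _).trans (ENNReal.tsum_le_tsum fun s => (hbad s).2)).trans_lt hT
  have hmeas : MeasurableSet (⋃ s, bad s) := MeasurableSet.iUnion fun s => (hbad s).1
  refine ⟨y₀, (⋃ s, bad s)ᶜ, hmeas.compl, ?_, fun ω hω => ?_⟩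
  · rw [prob_compl_eq_one_sub hmeas]
    exact tsub_pos_of_lt hunion
  have hprec_eq : ∀ s, ∀ t ≤ s + 1,
      postPrec f r₀ t (stoppedPath (y ω) s) = postPrec f r₀ t (y ω) := fun s t hts =>
    postPrec_congr _ fun i hi => stoppedPath_apply_of_le _ (by omega)
  have hσ_eq : ∀ s, σ s (stoppedPath (y ω) s) = σ s (y ω) := fun s => by
    simp only [σ, hprec_eq s s (by omega), hprec_eq s (s + 1) le_rfl]
  have hA_mem : ∀ s, y ω ∈ A s → stoppedPath (y ω) s ∈ A s := fun s hs => by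
    simp only [A, Set.mem_ofPred_eq, hprec_eq s s (by omega), hprec_eq s (s + 1) le_rfl]
    exact hs
  have hgood : ∀ s, y ω ∈ A s →
      ε (s + T) * σ s (y ω) < |y ω (s + 1)| ∧ y ω (s + 1) ∉ slowSet f h := fun s hs => by
    have h1 : ω ∉ bad s := fun hb => hω (Set.mem_iUnion.2 ⟨s, hb⟩)
    have h2 := not_or.1 (fun h2 => h1 ⟨hA_mem s hs, h2⟩)
    rw [hσ_eq, not_le] at h2
    exact h2
  have hε : ∀ n, 0 < ε n := fun n => by
    simp only [ε]
    positivity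
  -- Off all bad events the invariant at time s yields a good next output, which propagates the
  -- invariant.
  have hinv : ∀ s, y ω ∈ A s := by
    intro s
    induction s with
    | zero =>
      have h0 : y ω 0 = y₀ := output_zero ..
      simpa [A, postPrec, h0] using hbase
    | succ s ih =>
      obtain ⟨h1, h2⟩ := hgood s ih
      have := FastGrowth.step (by omega) (hc (s + T)) (postPrec_pos hr₀ s (y ω))
        (postPrec_pos hr₀ (s + 1) (y ω)) ih (hε (s + T))
        (le_add_of_nonneg_right (by positivity)) h1 h2
      rw [← postPrec_succ] at this
      simpa only [A, Set.mem_ofPred_eq, Nat.add_right_comm s 1 T] using this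
  refine limsup_mean_sq_eq_top (T := T) fun s => ?_
  refine le_trans ?_ (hgood s (hinv s)).1.le
  rw [add_comm T s]
  refine mul_le_mul (le_add_of_nonneg_left ENNReal.toReal_nonneg) ?_ (by positivity) (hε _).le
  rw [← Real.le_log_iff_exp_le (hσ0 s _)]
  exact hlogσ s _ (hinv s)
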